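/- A (right) near-ring is a group $(N,+)$, not necessarily abelian, with an associative multiplication satisfying $(a+b)c=ac+bc$. Let $N$ be a zero symmetric near-ring ($0n=n0=0$ for all $n$) with a two-sided identity $1$, and let $U$ be its group of units. For $u\in U$ let $\psi_u:n\mapsto nu$, an automorphism of $(N,+)$; then $\Psi_U=\{\psi_u : u\in U\}$ is a group of automorphisms. $N$ is an f-near-ring if every non-identity $\psi\in\Psi_U$ has $0$ as its only fixed point. $N$ has DCCN if it satisfies the descending chain condition on $N$-subgroups, i.e. subgroups $M$ of $(N,+)$ with $nm\in M$ for all $n\in N$, $m\in M$. An ideal of $N$ is a normal subgroup $I$ of $(N,+)$ with $in\in I$ and $a(b+i)-ab\in I$ for all $i\in I$ and $n,a,b\in N$; $N$ is simple if its only ideals are $\{0\}$ and $N$ (the zero near-ring is allowed). $N$ is a ring if $+$ is commutative and $a(b+c)=ab+ac$ for all $a,b,c\in N$. $N$ is a near-field if $N\neq\{0\}$ and every non-zero element of $N$ is a unit. **Theorem.** Let $N$ be a simple f-near-ring with DCCN and let $U$ be its group of units. 1. If $N$ is a ring and $|U|=1$, then $N$ is isomorphic to a direct product $\mathbb{Z}_2^k$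 of finitely many copies of the field $\mathbb{Z}_2$ (for some $k\ge 0$; $k=0$ occurs only for $N=\{0\}$). 2. If $N$ is a ring and $|U|\ge 2$, then $N$ is a field, not necessarily commutative (that is, a skew field: a ring which is also a near-field). 3. If $N$ is not a ring, then $N$ is a near-field. -/

import Mathlib

/-- A (right) near-ring: a group `(N, +)`, not assumed commutative, and a semigroup `(N, *)`
with the right distributive law `(a + b) * c = a * c + b * c`. -/
class NearRing (N : Type*) extends AddGroup N, Semigroup N where
  protected add_mul : ∀ a b c : N, (a + b) * c = a * c + b * c

/-- A zero symmetric near-ring with identity: a near-ring with a two-sided identity `1` for `*`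
such that `0 * n = n * 0 = 0`. The identities `1 ≠ 0` and `a + b = b + a` are not assumed. -/
class ZeroSymmNearRing (N : Type*) extends NearRing N, MonoidWithZero N

namespace NearRing

section FixedPointFree

variable {G : Type*} [AddGroup G]

/-- An automorphism of an additive group is fixed point free if `0` is its only fixed point. -/
def IsFixedPointFree (φ : AddAut G) : Prop :=
  ∀ g : G, φ g = g → g = 0

/-- A fixed point free automorphism group: every non-identity automorphism in it is
fixed point free. (The group `AddAut G` of automorphisms of `G` under composition is written
additively, so its subgroups are of type `AddSubgroup (AddAut G)`.) -/
def IsFixedPointFreeGroup (Φ : AddSubgroup (AddAut G)) : Prop :=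
  ∀ φ ∈ Φ, φ ≠ AddEquiv.refl G → IsFixedPointFree φ

end FixedPointFree

section Units

variable {N : Type*} [ZeroSymmNearRing N]

/-- The right translation `ψ_u : n ↦ n * u` by a unit `u`, an automorphism of `(N, +)`. -/
def rightTranslation (u : Nˣ) : AddAut N where
  toFun n := n * (u : N)
  invFun n := n * ((u⁻¹ : Nˣ) : N)
  left_inv n := by simp [mul_assoc]
  right_inv n := by simp [mul_assoc]
  map_add' a b := NearRing.add_mul a b (u : N)

variable (N)

/-- The group `Ψ_U = {ψ_u | u a unit}` of automorphisms of `(N, +)`, under composition. -/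
def unitTranslations : AddSubgroup (AddAut N) where
  carrier := Set.range (rightTranslation (N := N))
  zero_mem' := ⟨1, by ext n; simp [rightTranslation]⟩
  add_mem' := by
    rintro _ _ ⟨u, rfl⟩ ⟨v, rfl⟩
    exact ⟨v * u, by ext n; simp [rightTranslation, mul_assoc]⟩
  neg_mem' := by
    rintro _ ⟨u, rfl⟩
    exact ⟨u⁻¹, rfl⟩

/-- An f-near-ring: a zero symmetric near-ring with identity whose units act, by right
translations, as a fixed point free automorphism group on `(N, +)`. -/
def IsFNearRing : Prop :=
  IsFixedPointFreeGroup (unitTranslations N)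

/-- A near-field: the non-zero elements are all units and form a group under multiplication
(so there is at least one). -/
def IsNearField : Prop :=
  Nontrivial N ∧ ∀ a : N, a ≠ 0 → IsUnit a

end Units

section Structure

variable {N : Type*} [NearRing N]

/-- An `N`-subgroup of `N`: a subgroup `M` of `(N, +)` with `n * m ∈ M` for all `n ∈ N`,
`m ∈ M`. -/
def IsNSubgroup (M : AddSubgroup N) : Prop :=
  ∀ n : N, ∀ m ∈ M, n * m ∈ M

/-- A (two-sided) ideal of a near-ring: a normal subgroup `I` of `(N, +)` with `I * N ⊆ I` and
`a * (b + i) - a * b ∈ I` for all `a, b ∈ N`, `i ∈ I`. -/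
structure IsIdeal (I : AddSubgroup N) : Prop where
  normal : I.Normal
  mul_mem : ∀ i ∈ I, ∀ n : N, i * n ∈ I
  mul_add_sub_mem : ∀ a b : N, ∀ i ∈ I, a * (b + i) - a * b ∈ I

variable (N)

/-- The descending chain condition for `N`-subgroups of `N`. -/
def HasDCCN : Prop :=
  ∀ M : ℕ → AddSubgroup N, (∀ k, IsNSubgroup (M k)) → (∀ k, M (k + 1) ≤ M k) →
    ∃ n, ∀ k, n ≤ k → M k = M n

/-- A near-ring is simple if `{0}` and `N` are its only ideals. (The zero near-ring is not
excluded.) -/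
def IsSimple : Prop :=
  ∀ I : AddSubgroup N, IsIdeal I → I = ⊥ ∨ I = ⊤

/-- A near-ring is a ring if addition is commutative and the left distributive law holds too. -/
def IsRing : Prop :=
  (∀ a b : N, a + b = b + a) ∧ ∀ a b c : N, a * (b + c) = a * b + a * c

end Structure

/-- A field, not necessarily commutative (a skew field): a ring with identity in which the
non-zero elements form a group under multiplication. -/
def IsSkewField (N : Type*) [ZeroSymmNearRing N] : Prop :=
  IsRing N ∧ IsNearField N

end NearRing

/-! A minimal nonzero `N`-subgroup `M` is generated by each of its nonzero elements. Its annihilator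
is an ideal missing `1`, so by simplicity `N` acts faithfully on `M`. It suffices to find `m` in `M`
with zero annihilator (`IsFaithfulTypeTwo.isNearField`).

If `N` is not a ring, `density` prescribes values freely on finite sets with distinct annihilators,
and DCCN yields such a set `S` with zero joint annihilator. Two points of `S` would give an
involution `u` swapping them and a nonzero `n` constant on its orbits, so `n * u = n`, against fixed
point freeness. Hence `S` is a single point.

If `N` is a ring, `x * x = 0` makes `1 + x` a unit fixing `x`, so `N` is reduced; then an element
killing one nonzero `m` kills `N m = M`. -/

namespace NearRing

section Basic

variable {N : Type*} [NearRing N]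

/-- Under the descending chain condition, a nonempty family of `N`-subgroups has a minimal
member. -/
theorem HasDCCN.exists_minimal (hd : HasDCCN N) (P : AddSubgroup N → Prop)
    (hP : ∀ M, P M → IsNSubgroup M) (hne : ∃ M, P M) :
    ∃ M, P M ∧ ∀ M', P M' → M' ≤ M → M' = M := by
  by_contra! h
  obtain ⟨M₀, hM₀⟩ := hne
  choose g hgP hgle hgne using h
  let s : ℕ → {M // P M} := fun n =>
    Nat.rec ⟨M₀, hM₀⟩ (fun _ M => ⟨g M.1 M.2, hgP M.1 M.2⟩) n
  obtain ⟨n, hn⟩ := hd (fun k => (s k).1) (fun k => hP _ (s k).2)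
    (fun k => hgle (s k).1 (s k).2)
  exact hgne (s n).1 (s n).2 (hn (n + 1) (Nat.le_succ n))

end Basic

/-! ### Annihilators and faithful minimal `N`-subgroups -/

section ZeroSymm

variable {N : Type*} [ZeroSymmNearRing N]

protected theorem neg_mul' (a b : N) : -a * b = -(a * b) := by
  apply eq_neg_of_add_eq_zero_left
  rw [← NearRing.add_mul, neg_add_cancel, zero_mul]

protected theorem sub_mul' (a b c : N) : (a - b) * c = a * c - b * c := by
  rw [sub_eq_add_neg, NearRing.add_mul, NearRing.neg_mul', ← sub_eq_add_neg]

/-- In an f-near-ring, right multiplication by a unit other than `1` fixes only `0`. -/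
theorem IsFNearRing.eq_one (hf : IsFNearRing N) {n : N} (hn : n ≠ 0) (u : Nˣ)
    (h : n * (u : N) = n) : u = 1 := by
  by_contra hu
  refine hn (hf (rightTranslation u) ⟨u, rfl⟩ (fun hid => hu ?_) n h)
  have := DFunLike.congr_fun hid (1 : N)
  exact Units.ext (by simpa [rightTranslation] using this)

/-- The common annihilator of a set of elements. -/
def annihilator (S : Set N) : AddSubgroup N where
  carrier := {n | ∀ m ∈ S, n * m = 0}
  zero_mem' _ _ := zero_mul _
  add_mem' ha hb m hm := by rw [NearRing.add_mul, ha m hm, hb m hm, add_zero]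
  neg_mem' ha m hm := by rw [NearRing.neg_mul', ha m hm, neg_zero]

theorem mem_annihilator {S : Set N} {n : N} : n ∈ annihilator S ↔ ∀ m ∈ S, n * m = 0 :=
  Iff.rfl

theorem isNSubgroup_annihilator (S : Set N) : IsNSubgroup (annihilator S) := fun n a ha m hm => by
  rw [mul_assoc, ha m hm, mul_zero]

/-- The annihilator of an `N`-subgroup is an ideal. -/
theorem isIdeal_annihilator {M : AddSubgroup N} (hM : IsNSubgroup M) :
    IsIdeal (annihilator (M : Set N)) where
  normal := ⟨fun a ha g m hm => by
    rw [NearRing.add_mul, NearRing.add_mul, ha m hm, NearRing.neg_mul', add_zero,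
      add_neg_cancel]⟩
  mul_mem a ha n m hm := by rw [mul_assoc]; exact ha _ (hM n m hm)
  mul_add_sub_mem a b i hi m hm := by
    rw [NearRing.sub_mul', mul_assoc, mul_assoc, NearRing.add_mul, hi m hm, add_zero, sub_self]

/-- The `N`-subgroup `N m` generated by `m`. -/
def principal (m : N) : AddSubgroup N where
  carrier := {x | ∃ n, n * m = x}
  zero_mem' := ⟨0, zero_mul m⟩
  add_mem' := by
    rintro _ _ ⟨a, rfl⟩ ⟨b, rfl⟩
    exact ⟨a + b, NearRing.add_mul a b m⟩
  neg_mem' := by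
    rintro _ ⟨a, rfl⟩
    exact ⟨-a, NearRing.neg_mul' a m⟩

theorem isNSubgroup_principal (m : N) : IsNSubgroup (principal m) := by
  rintro n _ ⟨a, rfl⟩
  exact ⟨n * a, mul_assoc n a m⟩

/-- A faithful `N`-subgroup of type 2: it is nonzero, generated by each of its nonzero elements,
and only `0` annihilates it. -/
structure IsFaithfulTypeTwo (M : AddSubgroup N) : Prop where
  nsubgroup : IsNSubgroup M
  ne_bot : M ≠ ⊥
  exists_mul_eq : ∀ m ∈ M, m ≠ 0 → ∀ x ∈ M, ∃ n, n * m = x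
  faithful : ∀ a : N, (∀ m ∈ M, a * m = 0) → a = 0

/-- A nonzero simple near-ring with descending chain condition is 2-primitive. -/
theorem exists_isFaithfulTypeTwo [Nontrivial N] (hs : IsSimple N) (hd : HasDCCN N) :
    ∃ M : AddSubgroup N, IsFaithfulTypeTwo M := by
  obtain ⟨M, ⟨hN, hne⟩, hmin⟩ := hd.exists_minimal (fun M => IsNSubgroup M ∧ M ≠ ⊥)
    (fun _ h => h.1) ⟨⊤, fun _ _ _ => trivial, top_ne_bot⟩
  refine ⟨M, hN, hne, fun m hm hm0 x hx => ?_, fun a ha => ?_⟩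
  · have hle : principal m ≤ M := by
      rintro _ ⟨a, rfl⟩
      exact hN a m hm
    have hmm : m ∈ principal m := ⟨1, one_mul m⟩
    have : principal m = M := hmin _ ⟨isNSubgroup_principal m,
      fun hb => hm0 (by rwa [hb, AddSubgroup.mem_bot] at hmm)⟩ hle
    rw [← this] at hx
    exact hx
  · rcases hs _ (isIdeal_annihilator hN) with h | h
    · have : a ∈ annihilator (M : Set N) := ha
      rwa [h, AddSubgroup.mem_bot] at this
    · refine absurd ((AddSubgroup.eq_bot_iff_forall M).2 fun m hm => ?_) hne
      have : (1 : N) ∈ annihilator (M : Set N) := h ▸ AddSubgroup.mem_top _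
      simpa using this m hm

namespace IsFaithfulTypeTwo

variable {M : AddSubgroup N}

/-- If some element of `M` has zero annihilator, then `N` is a near-field. -/
theorem isNearField (hM : IsFaithfulTypeTwo M) {m : N} (hm : m ∈ M)
    (h : ∀ a : N, a * m = 0 → a = 0) : IsNearField N := by
  have hm0 : m ≠ 0 := by
    rintro rfl
    refine hM.ne_bot ((AddSubgroup.eq_bot_iff_forall M).2 fun x _ => h x (mul_zero x))
  have left : ∀ a : N, a ≠ 0 → ∃ b, b * a = 1 := fun a ha => by
    -- Some `b` carries `a * m` back to `m`, so `b * a - 1` kills `m`.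
    obtain ⟨b, hb⟩ := hM.exists_mul_eq (a * m) (hM.nsubgroup a m hm) (fun h0 => ha (h a h0)) m hm
    refine ⟨b, sub_eq_zero.1 (h _ ?_)⟩
    rw [NearRing.sub_mul', mul_assoc, hb, one_mul, sub_self]
  refine ⟨⟨m, 0, hm0⟩, fun a ha => ?_⟩
  obtain ⟨b, hb⟩ := left a ha
  have hb0 : b ≠ 0 := by
    rintro rfl
    rw [zero_mul] at hb
    exact hm0 (by rw [← one_mul m, ← hb, zero_mul])
  obtain ⟨c, hc⟩ := left b hb0
  have hca : c = a := by rw [← mul_one c, ← hb, ← mul_assoc, hc, one_mul]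
  exact ⟨⟨a, b, hca ▸ hc, hb⟩, rfl⟩

/-- Annihilators of nonzero elements of `M` with `ann i ≠ ann j` satisfy `ann i ⊄ ann j`. -/
theorem exists_mul_eq_zero (hM : IsFaithfulTypeTwo M) {i j : N} (hi : i ∈ M)
    (hj0 : j ≠ 0) (hij : ¬ ∀ a, a * i = 0 ↔ a * j = 0) :
    ∃ b, b * i = 0 ∧ b * j ≠ 0 := by
  by_contra! h
  refine hij fun c => ⟨h c, fun hc => ?_⟩
  by_contra hci
  obtain ⟨d, hd⟩ := hM.exists_mul_eq (c * i) (hM.nsubgroup c i hi) hci i hi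
  -- `d * c - 1` kills `i`, yet sends `j` to `-j` because `c * j = 0`.
  have h1 : (d * c - 1) * j = 0 := h _ (by
    rw [NearRing.sub_mul', mul_assoc, hd, one_mul, sub_self])
  rw [NearRing.sub_mul', mul_assoc, hc, mul_zero, one_mul, zero_sub, neg_eq_zero] at h1
  exact hj0 h1

/-- If `A` and `B` are annihilators of sets, `A ∩ B` annihilates `j`, and each of `A`, `B` maps `j`
onto `M`, then `N` is a ring. -/
theorem isRing_of_inf_annihilator (hM : IsFaithfulTypeTwo M) {S T : Set N} {j : N}
    (hS : ∀ x ∈ M, ∃ a ∈ annihilator S, a * j = x)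
    (hT : ∀ x ∈ M, ∃ b ∈ annihilator T, b * j = x)
    (hST : ∀ c, c ∈ annihilator S → c ∈ annihilator T → c * j = 0) : IsRing N := by
  have hcomm : ∀ x ∈ M, ∀ y ∈ M, x + y = y + x := by
    intro x hx y hy
    obtain ⟨a, ha, rfl⟩ := hS x hx
    obtain ⟨b, hb, rfl⟩ := hT y hy
    -- On `S` only `b` survives and on `T` only `a`, so the order of summation is invisible on both.
    have := hST (a + b - (b + a))
      (fun m hm => by
        rw [NearRing.sub_mul', NearRing.add_mul, NearRing.add_mul, ha m hm, zero_add, add_zero,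
          sub_self])
      (fun m hm => by
        rw [NearRing.sub_mul', NearRing.add_mul, NearRing.add_mul, hb m hm, zero_add, add_zero,
          sub_self])
    rwa [NearRing.sub_mul', NearRing.add_mul, NearRing.add_mul, sub_eq_zero] at this
  have hadd : ∀ c : N, ∀ x ∈ M, ∀ y ∈ M, c * (x + y) = c * x + c * y := by
    intro c x hx y hy
    obtain ⟨a, ha, rfl⟩ := hS x hx
    obtain ⟨b, hb, rfl⟩ := hT y hy
    have := hST (c * (a + b) - (c * a + c * b))
      (fun m hm => by
        rw [NearRing.sub_mul', NearRing.add_mul, mul_assoc, mul_assoc, mul_assoc,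
          NearRing.add_mul, ha m hm, mul_zero, zero_add, zero_add, sub_self])
      (fun m hm => by
        rw [NearRing.sub_mul', NearRing.add_mul, mul_assoc, mul_assoc, mul_assoc,
          NearRing.add_mul, hb m hm, mul_zero, add_zero, add_zero, sub_self])
    rwa [NearRing.sub_mul', NearRing.add_mul, mul_assoc, mul_assoc, mul_assoc,
      NearRing.add_mul, sub_eq_zero] at this
  refine ⟨fun a b => ?_, fun a b c => ?_⟩
  · refine sub_eq_zero.1 (hM.faithful _ fun m hm => ?_)
    rw [NearRing.sub_mul', NearRing.add_mul, NearRing.add_mul,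
      hcomm _ (hM.nsubgroup a m hm) _ (hM.nsubgroup b m hm), sub_self]
  · refine sub_eq_zero.1 (hM.faithful _ fun m hm => ?_)
    rw [NearRing.sub_mul', NearRing.add_mul, mul_assoc, mul_assoc, mul_assoc, NearRing.add_mul,
      hadd a _ (hM.nsubgroup b m hm) _ (hM.nsubgroup c m hm), sub_self]

/-- If `N` is not a ring and no element of the finite set `S` has the same annihilator as `j`,
then the annihilator of `S` maps `j` onto `M`. -/
theorem exists_annihilator_mul_eq (hM : IsFaithfulTypeTwo M) (hr : ¬ IsRing N) (S : Finset N)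
    {j : N} (hj : j ∈ M) (hj0 : j ≠ 0)
    (hS : ∀ i ∈ S, i ∈ M ∧ i ≠ 0 ∧ ¬ ∀ a, a * i = 0 ↔ a * j = 0) :
    ∀ x ∈ M, ∃ a ∈ annihilator (S : Set N), a * j = x := by
  classical
  -- One nonzero image of `j` suffices, since it generates `M`.
  have extend : ∀ T : Set N, (∃ a ∈ annihilator T, a * j ≠ 0) →
      ∀ x ∈ M, ∃ a ∈ annihilator T, a * j = x := by
    rintro T ⟨a, ha, haj⟩ x hx
    obtain ⟨c, hc⟩ := hM.exists_mul_eq _ (hM.nsubgroup a j hj) haj x hx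
    exact ⟨c * a, isNSubgroup_annihilator T c a ha, by rw [mul_assoc, hc]⟩
  induction S using Finset.induction_on with
  | empty => exact extend _ ⟨1, by simp [mem_annihilator], by rwa [one_mul]⟩
  | insert i T _ ih =>
    have hi := hS i (Finset.mem_insert_self i T)
    refine extend _ ?_
    by_contra! h
    obtain ⟨b, hbi, hbj⟩ := hM.exists_mul_eq_zero hi.1 hj0 hi.2.2
    -- If everything killing both `T` and `i` killed `j`, the annihilators of `T` and `{i}` would
    -- force `N` to be a ring.
    refine hr (hM.isRing_of_inf_annihilator (T := {i})
      (ih fun k hk => hS k (Finset.mem_insert_of_mem hk))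
      (extend {i} ⟨b, by simpa [mem_annihilator] using hbi, hbj⟩) fun c hcT hci => h c ?_)
    intro m hm
    rcases Finset.mem_insert.1 (Finset.mem_coe.1 hm) with rfl | hm
    · exact hci _ rfl
    · exact hcT m hm

/-! ### Independent sets and density -/

/-- A finite set of nonzero elements of `M` with pairwise distinct annihilators. -/
def IsIndependent (M : AddSubgroup N) (S : Finset N) : Prop :=
  (∀ i ∈ S, i ∈ M ∧ i ≠ 0) ∧ ∀ i ∈ S, ∀ j ∈ S, i ≠ j → ¬ ∀ a, a * i = 0 ↔ a * j = 0

/-- Density: if `N` is not a ring, the elements of an independent set can be mapped to arbitrary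
elements of `M` simultaneously. -/
theorem density (hM : IsFaithfulTypeTwo M) (hr : ¬ IsRing N) (S : Finset N)
    (hS : IsIndependent M S) (f : N → N) (hf : ∀ i ∈ S, f i ∈ M) :
    ∃ n : N, ∀ i ∈ S, n * i = f i := by
  classical
  induction S using Finset.induction_on with
  | empty => exact ⟨0, by simp⟩
  | insert j T hjT ih =>
    obtain ⟨n, hn⟩ := ih
      ⟨fun i hi => hS.1 i (Finset.mem_insert_of_mem hi), fun i hi k hk =>
        hS.2 i (Finset.mem_insert_of_mem hi) k (Finset.mem_insert_of_mem hk)⟩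
      (fun i hi => hf i (Finset.mem_insert_of_mem hi))
    have hj := Finset.mem_insert_self j T
    -- The correction `a` vanishes on `T`; its value at `j` is ordered for a non-commutative sum.
    obtain ⟨a, ha, haj⟩ := hM.exists_annihilator_mul_eq hr T (hS.1 j hj).1 (hS.1 j hj).2
      (fun i hi => ⟨(hS.1 i (Finset.mem_insert_of_mem hi)).1,
        (hS.1 i (Finset.mem_insert_of_mem hi)).2,
        hS.2 i (Finset.mem_insert_of_mem hi) j hj (fun h => hjT (h ▸ hi))⟩)
      (-(n * j) + f j) (M.add_mem (M.neg_mem (hM.nsubgroup n j (hS.1 j hj).1)) (hf j hj))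
    refine ⟨n + a, fun i hi => ?_⟩
    rw [NearRing.add_mul]
    rcases Finset.mem_insert.1 hi with rfl | hi
    · rw [haj, add_neg_cancel_left]
    · rw [hn i hi, ha i hi, add_zero]

/-- Under the descending chain condition there is an independent set with zero annihilator. -/
theorem exists_isIndependent (hM : IsFaithfulTypeTwo M) (hd : HasDCCN N) :
    ∃ S : Finset N, IsIndependent M S ∧ ∀ a : N, (∀ i ∈ S, a * i = 0) → a = 0 := by
  classical
  obtain ⟨_, ⟨S, hS, rfl⟩, hmin⟩ := hd.exists_minimal
    (fun A => ∃ S : Finset N, IsIndependent M S ∧ annihilator (S : Set N) = A)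
    (by rintro _ ⟨S, _, rfl⟩; exact isNSubgroup_annihilator _)
    ⟨_, ∅, by simp [IsIndependent], rfl⟩
  refine ⟨S, hS, fun a ha => hM.faithful a fun m hm => ?_⟩
  by_contra ham
  have hm0 : m ≠ 0 := by
    rintro rfl
    exact ham (mul_zero a)
  -- Since `a` kills `S` but not `m`, adjoining `m` keeps independence and strictly shrinks the
  -- annihilator, against minimality.
  have hSm : ∀ i ∈ S, ¬ ∀ b, b * i = 0 ↔ b * m = 0 := fun i hi h => ham ((h a).1 (ha i hi))
  have hins : IsIndependent M (insert m S) := by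
    refine ⟨fun i hi => ?_, fun i hi j hj hij => ?_⟩
    · rcases Finset.mem_insert.1 hi with rfl | hi
      exacts [⟨hm, hm0⟩, hS.1 i hi]
    · rcases Finset.mem_insert.1 hi with rfl | hiS <;>
        rcases Finset.mem_insert.1 hj with rfl | hjS
      · exact absurd rfl hij
      · exact fun h => hSm j hjS fun b => (h b).symm
      · exact hSm i hiS
      · exact hS.2 i hiS j hjS hij
  have heq := hmin _ ⟨insert m S, hins, rfl⟩
    (fun b hb i hi => hb i (Finset.mem_coe.2 (Finset.mem_insert_of_mem hi)))
  have : a ∈ annihilator ((insert m S : Finset N) : Set N) := by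
    rw [heq]
    exact ha
  exact ham (this m (Finset.mem_coe.2 (Finset.mem_insert_self m S)))

end IsFaithfulTypeTwo

/-! ### The non-ring case -/

/-- A simple f-near-ring with descending chain condition that is not a ring is a near-field. -/
theorem isNearField_of_not_isRing (hf : IsFNearRing N) (hs : IsSimple N) (hd : HasDCCN N)
    (hr : ¬ IsRing N) : IsNearField N := by
  classical
  have : Nontrivial N := by
    by_contra h
    rw [not_nontrivial_iff_subsingleton] at h
    exact hr ⟨fun _ _ => Subsingleton.elim _ _, fun _ _ _ => Subsingleton.elim _ _⟩
  obtain ⟨M, hM⟩ := exists_isFaithfulTypeTwo hs hd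
  obtain ⟨S, hS, hS0⟩ := hM.exists_isIndependent hd
  by_cases hcard : ∃ p ∈ S, ∃ q ∈ S, p ≠ q
  · obtain ⟨p, hp, q, hq, hpq⟩ := hcard
    have hmem : ∀ i ∈ S, Equiv.swap p q i ∈ S := fun i hi => by
      rw [Equiv.swap_apply_def]
      split_ifs <;> assumption
    obtain ⟨u, hu⟩ := hM.density hr S hS (Equiv.swap p q) fun i hi => (hS.1 _ (hmem i hi)).1
    obtain ⟨n, hn⟩ := hM.density hr S hS (fun i => if i = p ∨ i = q then p else 0) fun i _ => by
      split_ifs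
      exacts [(hS.1 p hp).1, M.zero_mem]
    have huu : u * u = 1 := sub_eq_zero.1 <| hS0 _ fun i hi => by
      rw [NearRing.sub_mul', mul_assoc, hu i hi, hu _ (hmem i hi), Equiv.swap_apply_self, one_mul,
        sub_self]
    have hnu : n * u = n := sub_eq_zero.1 <| hS0 _ fun i hi => by
      rw [NearRing.sub_mul', mul_assoc, hu i hi, hn _ (hmem i hi), hn i hi, sub_eq_zero]
      rcases eq_or_ne i p with rfl | hip
      · simp
      rcases eq_or_ne i q with rfl | hiq
      · simp
      rw [Equiv.swap_apply_of_ne_of_ne hip hiq]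
    have hn0 : n ≠ 0 := by
      rintro rfl
      have := hn p hp
      rw [zero_mul, if_pos (Or.inl rfl)] at this
      exact (hS.1 p hp).2 this.symm
    have h1 : u = 1 := congrArg Units.val (hf.eq_one hn0 ⟨u, u, huu, huu⟩ hnu)
    have := hu p hp
    rw [h1, one_mul, Equiv.swap_apply_left] at this
    exact absurd this hpq
  · push Not at hcard
    rcases S.eq_empty_or_nonempty with rfl | ⟨m, hm⟩
    · exact absurd (hS0 1 (by simp)) one_ne_zero
    · exact hM.isNearField (hS.1 m hm).1 fun a ha => hS0 a fun i hi => hcard i hi m hm ▸ ha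

/-! ### The ring case -/

/-- An f-near-ring which is a ring is reduced. -/
theorem IsRing.eq_zero_of_mul_self (hr : IsRing N) (hf : IsFNearRing N) {x : N}
    (hx : x * x = 0) : x = 0 := by
  by_contra hx0
  have h1 : (1 + x) * (1 + -x) = 1 := by
    have hneg : x * -x = 0 := by
      have := hr.2 x x (-x)
      rwa [add_neg_cancel, mul_zero, hx, zero_add, eq_comm] at this
    rw [hr.2, mul_one, NearRing.add_mul, one_mul, hneg, add_zero, add_neg_cancel_right]
  have h2 : (1 + -x) * (1 + x) = 1 := by
    rw [hr.2, mul_one, NearRing.add_mul, one_mul, NearRing.neg_mul', hx, neg_zero, add_zero,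
      neg_add_cancel_right]
  have hu := hf.eq_one hx0 ⟨1 + x, 1 + -x, h1, h2⟩ (by
    change x * (1 + x) = x
    rw [hr.2, hx, mul_one, add_zero])
  have : 1 + x = 1 := congrArg Units.val hu
  exact hx0 (by simpa using this)

/-- A nonzero simple f-near-ring with descending chain condition that is a ring is a near-field. -/
theorem isNearField_of_isRing [Nontrivial N] (hf : IsFNearRing N) (hs : IsSimple N)
    (hd : HasDCCN N) (hr : IsRing N) : IsNearField N := by
  obtain ⟨M, hM⟩ := exists_isFaithfulTypeTwo hs hd
  obtain ⟨m, hm, hm0⟩ := M.bot_or_exists_ne_zero.resolve_left hM.ne_bot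
  refine hM.isNearField hm fun a ha => hM.faithful a fun x hx => ?_
  obtain ⟨r, rfl⟩ := hM.exists_mul_eq m hm hm0 x hx
  -- Reducedness turns `a * m = 0` into `m * a = 0`, which makes `a * (r * m)` square to zero.
  have hma : m * a = 0 := hr.eq_zero_of_mul_self hf (by
    rw [mul_assoc, ← mul_assoc a, ha, zero_mul, mul_zero])
  refine hr.eq_zero_of_mul_self hf ?_
  calc a * (r * m) * (a * (r * m)) = a * (r * ((m * a) * (r * m))) := by simp only [mul_assoc]
    _ = 0 := by rw [hma, zero_mul, mul_zero, mul_zero]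

/-- A near-field with only one unit that is a ring is isomorphic to `ℤ/2`. -/
theorem nonempty_ringEquiv_zmod_two (hr : IsNearField N) (hU : Subsingleton Nˣ) :
    Nonempty (N ≃+* (Fin 1 → ZMod 2)) := by
  classical
  have := hr.1
  have hall : ∀ a : N, a ≠ 0 → a = 1 := fun a ha => by
    obtain ⟨u, rfl⟩ := hr.2 a ha
    rw [Subsingleton.elim u 1, Units.val_one]
  -- Otherwise `1 + 1 = 1`, since `1` is the only nonzero element.
  have h11 : (1 : N) + 1 = 0 := by
    by_contra h
    exact one_ne_zero (α := N) (by simpa using hall _ h)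
  have hz : (1 : ZMod 2) + 1 = 0 := by decide
  refine ⟨{
    toFun := fun a _ => if a = 0 then 0 else 1
    invFun := fun f => if f 0 = 0 then 0 else 1
    left_inv := fun a => ?_
    right_inv := fun f => ?_
    map_mul' := fun a b => ?_
    map_add' := fun a b => ?_ }⟩
  · by_cases ha : a = 0
    · simp [ha]
    · simp [hall a ha]
  · funext i
    rw [Subsingleton.elim i 0]
    change (if (if f 0 = 0 then (0 : N) else 1) = 0 then (0 : ZMod 2) else 1) = f 0
    have hz01 : ∀ z : ZMod 2, z = 0 ∨ z = 1 := by decide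
    rcases hz01 (f 0) with h | h <;> simp [h]
  · funext i
    by_cases ha : a = 0
    · simp [ha]
    · simp [hall a ha]
  · funext i
    by_cases ha : a = 0
    · simp [ha]
    by_cases hb : b = 0
    · simp [hb]
    simp [hall a ha, hall b hb, h11, hz]

end ZeroSymm

end NearRing

theorem mainTheorem3 {N : Type*} [ZeroSymmNearRing N]
    (hf : NearRing.IsFNearRing N) (hsimple : NearRing.IsSimple N) (hdccn : NearRing.HasDCCN N) :
    (NearRing.IsRing N → ENat.card Nˣ = 1 →
      ∃ k : ℕ, Nonempty (N ≃+* (Fin k → ZMod 2))) ∧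
    (NearRing.IsRing N → 2 ≤ ENat.card Nˣ → NearRing.IsSkewField N) ∧
    (¬ NearRing.IsRing N → NearRing.IsNearField N) := by
  refine ⟨fun hr hU => ?_, fun hr hU => ?_, fun hr =>
    NearRing.isNearField_of_not_isRing hf hsimple hdccn hr⟩
  -- Simplicity leaves only `k = 0` and `k = 1`.
  · rcases subsingleton_or_nontrivial N with h | h
    · exact ⟨0, ⟨{
        toFun := fun _ => 0
        invFun := fun _ => 0
        left_inv := fun _ => Subsingleton.elim _ _
        right_inv := fun _ => Subsingleton.elim _ _
        map_mul' := fun _ _ => Subsingleton.elim _ _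
        map_add' := fun _ _ => Subsingleton.elim _ _ }⟩⟩
    · exact ⟨1, NearRing.nonempty_ringEquiv_zmod_two
        (NearRing.isNearField_of_isRing hf hsimple hdccn hr)
        ((ENat.card_le_one_iff_subsingleton _).1 hU.le)⟩
  · have : Nontrivial N := by
      by_contra h
      rw [not_nontrivial_iff_subsingleton] at h
      have : Subsingleton Nˣ := ⟨fun u v => Units.ext (Subsingleton.elim _ _)⟩
      exact absurd (hU.trans ((ENat.card_le_one_iff_subsingleton Nˣ).2 this)) (by norm_num)
    exact ⟨hr, NearRing.isNearField_of_isRing hf hsimple hdccn hr⟩
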